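/- Let $N\ge 1$, let $\delta>2N$ and $0<\delta'<1/N$ with $\delta\delta'=N$, and let $S=[0,1]^2$. Put $\mathcal A=\{a,b\}$, $\mathcal A'=\{0^1,\dots,0^N,1^1,\dots,1^N\}$ and $\varphi_1(0^i)=a$, $\varphi_1(1^i)=b$. Let $f:\mathbb R^2\to\mathbb R^2$ be an $N$-to-1 horseshoe map, that is, suppose that: (i) $S\cap f^{-1}(S)$ is the union of $2N$ pairwise disjoint vertical rectangles $V_s=[\ell_s,\ell_s+1/\delta]\times[0,1]\subset S$, $s\in\mathcal A'$; (ii) there are two disjoint horizontal rectangles $H_t=[0,1]\times[h_t,h_t+\delta']\subset S$, $t\in\mathcal A$, such that $f$ maps each $V_s$ affinely onto $H_{\varphi_1(s)}$ by $f(x,y)=(g_s(x),k_{\varphi_1(s)}(y))$, where $g_s:[\ell_s,\ell_s+1/\delta]\to[0,1]$ is an affine bijection of slope $\pm\delta$ and $k_t:[0,1]\to[h_t,h_t+\delta']$ is an affine bijection of slope $\pm\delta'$ (so the $N$ branches onto $H_t$ overlay: they have the same vertical component); (iii) $S\cap f^{-(k+1)}(S)\subseteq S\cap f^{-k}(S)$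 for all $k\ge 0$ (points that leave $S$ do not return). Let $$\Lambda=\bigcap_{k\ge0}\bigl(f^k(S)\cap S\bigr)\ \cap\ \bigcap_{k\ge 0}\bigl(f^{-k}(S)\cap S\bigr).$$ For letters $n_i\in\mathcal A'$ ($i\ge0$) and $n_i\in\mathcal A$ ($i\le-1$) put $$V_{n_0,\dots,n_k}=\bigcap_{i=0}^{k}f^{-i}(V_{n_i}),\qquad H_{n_{-k},\dots,n_{-1}}=\bigcap_{i=1}^{k}f^{\,i-1}(H_{n_{-i}}),$$ $$v=\bigcap_{k\ge0}V_{n_0,\dots,n_k},\qquad h=\bigcap_{k\ge1}H_{n_{-k},\dots,n_{-1}}.$$ Let $\Sigma_{\mathcal A,\mathcal A'}$ be the set of all sequences $(n_i)_{i\in\mathbb Z}$ of this kind with $v\cap h\ne\emptyset$, with the topology generated by cylinders (the product topology). Call $(n_i)$ a code of $p$ if $p\in v\cap h$. Then: 1. $\Sigma_{\mathcal A,\mathcal A'}$ is the full zip shift space of $\varphi_1$: it is the set of all $(x_i)_{i\in\mathbb Z}$ for which there is $y\in(\mathcal A')^{\mathbb Z}$ with $x_i=y_i$ for $i\ge0$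 and $x_i=\varphi_1(y_i)$ for $i<0$. 2. For all letters, $v$ is a vertical segment $\{x_0\}\times[0,1]$ and $h$ is a horizontal segment $[0,1]\times\{y_0\}$ with $x_0,y_0\in[0,1]$, and $v\cap h$ consists of exactly one point, which lies in $\Lambda$. Conversely, each point of $\Lambda$ is the unique point of $v\cap h$ for exactly one choice of the forward letters $(n_i)_{i\ge0}$ in $\mathcal A'$ and the backward letters $(n_i)_{i\le-1}$ in $\mathcal A$. 3. Each $p\in\Lambda$ has exactly one code $\varsigma(p)$, and the code map $\varsigma:\Lambda\to\Sigma_{\mathcal A,\mathcal A'}$ is a homeomorphism. -/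

import Mathlib

open Set

namespace ZipShift

/-- The zip shift space obtained from a set `Y` of two-sided sequences over `A'` and a transition
map `φ` on words of length `n`: a sequence `y ∈ Y` is kept at the indices `i ≥ 0`, and is replaced
by `φ (y_i ⋯ y_{i+n-1}) ∈ A` at the indices `i < 0`. The ambient space `ℤ → A ⊕ A'` carries the
product topology, for which the cylinders form a basis. -/
def zipShiftSpace {A A' : Type*} {n : ℕ} (Y : Set (ℤ → A')) (φ : (Fin n → A') → A) :
    Set (ℤ → A ⊕ A') :=
  {x | ∃ y ∈ Y, ∀ i : ℤ,
    x i = if 0 ≤ i then Sum.inr (y i) else Sum.inl (φ fun j => y (i + (j : ℕ)))}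

/-- The bi-infinite sequence `(…, t 1, t 0; s 0, s 1, …)`: the letter at `k ≥ 0` is `s k ∈ A'`,
and the letter at `-(k + 1)` is `t k ∈ A`. -/
def biseq {A A' : Type*} (t : ℕ → A) (s : ℕ → A') : ℤ → A ⊕ A'
  | Int.ofNat k => Sum.inr (s k)
  | Int.negSucc k => Sum.inl (t k)

/-- The alphabet `𝒜 = {a, b}`, with `a = false` and `b = true`. -/
abbrev BackLetter : Type := Bool

/-- The alphabet `𝒜' = {0¹, …, 0ᴺ} ∪ {1¹, …, 1ᴺ}`: `Sum.inl i` is a `0` and `Sum.inr i` a `1`. -/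
abbrev ForwLetter (N : ℕ) : Type := Fin N ⊕ Fin N

/-- The transition map `φ₁ : 𝒜' → 𝒜`, which sends every `0ⁱ` to `a` and every `1ⁱ` to `b`. -/
def trans {N : ℕ} : ForwLetter N → BackLetter
  | Sum.inl _ => false
  | Sum.inr _ => true

/-- The unit square. -/
def square : Set (ℝ × ℝ) := Icc 0 1 ×ˢ Icc 0 1

/-- An `N`-to-1 horseshoe map: the square is expanded horizontally by `δ`, contracted vertically by
`δ'`, cut or folded into `N` overlaying sheets of length `δ / N`, and the sheets are bent back so
that they cross the square in two horizontal rectangles. The part of the map that returns to the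
square consists of `2N` affine branches; how the bends look outside the square is left free. -/
structure Horseshoe (N : ℕ) where
  /-- the map -/
  f : ℝ × ℝ → ℝ × ℝ
  /-- the horizontal expansion factor -/
  δ : ℝ
  /-- the vertical contraction factor -/
  δ' : ℝ
  one_le : 1 ≤ N
  lt_expansion : 2 * (N : ℝ) < δ
  contraction_pos : 0 < δ'
  contraction_lt : δ' < 1 / (N : ℝ)
  expansion_mul_contraction : δ * δ' = N
  /-- the vertical rectangle `V_s` is `[left s, left s + 1 / δ] × [0, 1]` -/
  left : ForwLetter N → ℝ
  /-- the horizontal rectangle `H_t` is `[0, 1] × [base t, base t + δ']` -/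
  base : BackLetter → ℝ
  left_mem : ∀ s, 0 ≤ left s ∧ left s + 1 / δ ≤ 1
  base_mem : ∀ t, 0 ≤ base t ∧ base t + δ' ≤ 1
  left_disjoint : Pairwise fun s s' =>
    Disjoint (Icc (left s) (left s + 1 / δ)) (Icc (left s') (left s' + 1 / δ))
  base_disjoint : Pairwise fun t t' =>
    Disjoint (Icc (base t) (base t + δ')) (Icc (base t') (base t' + δ'))
  /-- whether the branch on `V_s` reverses the horizontal direction -/
  flipX : ForwLetter N → Bool
  /-- whether the branches onto `H_t` reverse the vertical direction; the `N` sheets overlay before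
  they are bent, so the `N` branches onto `H_t` have the same vertical component -/
  flipY : BackLetter → Bool
  /-- `f` maps `V_s` affinely onto `H_{φ₁ s}` -/
  f_branch : ∀ s, ∀ x ∈ Icc (left s) (left s + 1 / δ), ∀ y ∈ Icc (0 : ℝ) 1,
    f (x, y) = (if flipX s then 1 - δ * (x - left s) else δ * (x - left s),
      base (trans s) + if flipY (trans s) then δ' * (1 - y) else δ' * y)
  /-- `f⁻¹(S) ∩ S` is the union of the `2N` vertical rectangles -/
  preimage_eq : square ∩ f ⁻¹' square = ⋃ s, Icc (left s) (left s + 1 / δ) ×ˢ Icc 0 1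
  /-- `f⁻⁽ᵏ⁺¹⁾(S) ∩ S ⊆ f⁻ᵏ(S) ∩ S`: a point that has left the square does not come back -/
  nested : ∀ k : ℕ, square ∩ f^[k + 1] ⁻¹' square ⊆ square ∩ f^[k] ⁻¹' square

namespace Horseshoe

variable {N : ℕ} (F : Horseshoe N)

/-- The vertical rectangle `V_s`. -/
def V (s : ForwLetter N) : Set (ℝ × ℝ) := Icc (F.left s) (F.left s + 1 / F.δ) ×ˢ Icc 0 1

/-- The horizontal rectangle `H_t`. -/
def H (t : BackLetter) : Set (ℝ × ℝ) := Icc 0 1 ×ˢ Icc (F.base t) (F.base t + F.δ')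

/-- `Λ_H`, the limit (intersection) of the decreasing sets `fᵏ(S) ∩ S`. -/
def lambdaH : Set (ℝ × ℝ) := ⋂ k : ℕ, F.f^[k] '' square ∩ square

/-- `Λ_V`, the limit (intersection) of the decreasing sets `f⁻ᵏ(S) ∩ S`. -/
def lambdaV : Set (ℝ × ℝ) := ⋂ k : ℕ, F.f^[k] ⁻¹' square ∩ square

/-- The invariant set of the horseshoe. -/
def lambda : Set (ℝ × ℝ) := F.lambdaH ∩ F.lambdaV

/-- `V_{s 0, …, s k}`. -/
def Vword (s : ℕ → ForwLetter N) : ℕ → Set (ℝ × ℝ)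
  | 0 => F.V (s 0)
  | k + 1 => Vword s k ∩ F.f^[k + 1] ⁻¹' F.V (s (k + 1))

/-- `H_{t k, …, t 0}`, where `t j` is the letter at the index `-(j + 1)`. -/
def Hword (t : ℕ → BackLetter) : ℕ → Set (ℝ × ℝ)
  | 0 => F.H (t 0)
  | k + 1 => Hword t k ∩ F.f^[k + 1] '' F.H (t (k + 1))

/-- The limit of the nested sets `V_{s 0, …, s k}`. -/
def Vlim (s : ℕ → ForwLetter N) : Set (ℝ × ℝ) := ⋂ k, F.Vword s k

/-- The limit of the nested sets `H_{t k, …, t 0}`. -/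
def Hlim (t : ℕ → BackLetter) : Set (ℝ × ℝ) := ⋂ k, F.Hword t k

/-- `n` is a code of the point `p`. -/
def IsCode (p : ℝ × ℝ) (n : ℤ → BackLetter ⊕ ForwLetter N) : Prop :=
  ∃ t s, n = biseq t s ∧ p ∈ F.Vlim s ∩ F.Hlim t

/-- The space `Σ_{𝒜,𝒜'}` of the sequences whose limit segments meet. -/
def codeSpace : Set (ℤ → BackLetter ⊕ ForwLetter N) :=
  {n | ∃ t s, n = biseq t s ∧ (F.Vlim s ∩ F.Hlim t).Nonempty}

end Horseshoe

end ZipShift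

/-! On each `V_s` the map splits into coordinates: horizontally it inverts a contraction of ratio
`1/δ`, vertically it applies a contraction of ratio `δ'` depending only on `φ₁ s`, because the
sheets overlay. So the vertical and horizontal words are products of the unit interval with
cylinders of two iterated function systems with disjoint images, over `𝒜'` and `𝒜` (`Vword_eq`,
`Hword_eq`).

The delicate case is `Hword_eq`, which involves images under iterates of a non-injective map whose
behaviour off the square is free. Since points that leave do not return, an orbit segment with both
ends in the square follows the branches; disjointness then recovers its vertical word, and
surjectivity of `φ₁` realizes every word.

Cylinders of either system shrink to points, and a point determines its address. Thus each pair of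
one-sided sequences codes one point, and these points fill `Λ`. This continuous bijection from a
compact space is a homeomorphism onto `Λ`; rewriting the pairs as two-sided sequences gives the
inverse of the code map. -/

namespace ZipShift

/-! ### Iterated function systems on the unit interval -/

/-- An iterated function system of similarities of the unit interval with disjoint
images: `map a` contracts by the factor `ratio`. -/
structure UnitIFS (A : Type*) where
  /-- the branches -/
  map : A → ℝ → ℝ
  /-- the contraction factor -/
  ratio : ℝ
  ratio_pos : 0 < ratio
  ratio_lt : ratio < 1
  map_mem : ∀ a, ∀ x ∈ Icc (0 : ℝ) 1, map a x ∈ Icc (0 : ℝ) 1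
  dist_map : ∀ a x y, |map a x - map a y| = ratio * |x - y|
  eq_of_map_eq : ∀ a b, ∀ x ∈ Icc (0 : ℝ) 1, ∀ y ∈ Icc (0 : ℝ) 1, map a x = map b y → a = b

namespace UnitIFS

variable {A : Type*} (G : UnitIFS A)

/-- The composition `map (w 0) ∘ ⋯ ∘ map (w (k - 1))`. -/
def comp : (ℕ → A) → ℕ → ℝ → ℝ
  | _, 0, x => x
  | w, k + 1, x => G.map (w 0) (comp (fun i => w (i + 1)) k x)

/-- The image of the unit interval under `comp w k`. -/
def cyl (w : ℕ → A) (k : ℕ) : Set ℝ := G.comp w k '' Icc 0 1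

theorem map_injective (a : A) : Function.Injective (G.map a) := by
  intro x y h
  have h1 := G.dist_map a x y
  rw [h, sub_self, abs_zero] at h1
  have h2 : |x - y| = 0 := by
    rcases mul_eq_zero.1 h1.symm with h3 | h3
    · exact absurd h3 G.ratio_pos.ne'
    · exact h3
  exact sub_eq_zero.1 (abs_eq_zero.1 h2)

theorem comp_mem (w : ℕ → A) (k : ℕ) {x : ℝ} (hx : x ∈ Icc (0 : ℝ) 1) :
    G.comp w k x ∈ Icc (0 : ℝ) 1 := by
  induction k generalizing w with
  | zero => exact hx
  | succ k ih => exact G.map_mem _ _ (ih _)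

theorem dist_comp (w : ℕ → A) (k : ℕ) (x y : ℝ) :
    |G.comp w k x - G.comp w k y| = G.ratio ^ k * |x - y| := by
  induction k generalizing w with
  | zero => simp [comp]
  | succ k ih => rw [comp, comp, G.dist_map, ih, pow_succ]; ring

/-- The recursion peels off the outermost branch; peeling off the innermost one is what shows that
cylinders are nested. -/
theorem comp_succ_last (w : ℕ → A) (k : ℕ) (x : ℝ) :
    G.comp w (k + 1) x = G.comp w k (G.map (w k) x) := by
  induction k generalizing w with
  | zero => rfl
  | succ k ih => rw [comp, ih]; rfl

theorem comp_congr {w w' : ℕ → A} {k : ℕ} (h : ∀ j < k, w j = w' j) (x : ℝ) :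
    G.comp w k x = G.comp w' k x := by
  induction k generalizing w w' with
  | zero => rfl
  | succ k ih =>
    rw [comp, comp, h 0 (Nat.succ_pos k), ih fun j hj => h (j + 1) (by omega)]

/-- Disjoint images force the outermost letters to agree; injectivity then cancels that branch, and
the argument repeats. -/
theorem eq_of_comp_eq {w w' : ℕ → A} {k : ℕ} {x y : ℝ} (hx : x ∈ Icc (0 : ℝ) 1)
    (hy : y ∈ Icc (0 : ℝ) 1) (h : G.comp w k x = G.comp w' k y) : ∀ j < k, w j = w' j := by
  induction k generalizing w w' with
  | zero => intro j hj; omega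
  | succ k ih =>
    have h0 := G.eq_of_map_eq _ _ _ (G.comp_mem _ k hx) _ (G.comp_mem _ k hy) h
    rw [comp, comp, h0] at h
    have h1 := ih (G.map_injective _ h)
    intro j hj
    cases j with
    | zero => exact h0
    | succ j => exact h1 j (by omega)

theorem cyl_congr {w w' : ℕ → A} {k : ℕ} (h : ∀ j < k, w j = w' j) : G.cyl w k = G.cyl w' k :=
  image_congr fun x _ => G.comp_congr h x

theorem cyl_subset_unit (w : ℕ → A) (k : ℕ) : G.cyl w k ⊆ Icc 0 1 := by
  rintro _ ⟨x, hx, rfl⟩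
  exact G.comp_mem w k hx

theorem cyl_succ (w : ℕ → A) (k : ℕ) :
    G.cyl w (k + 1) = G.map (w 0) '' G.cyl (fun i => w (i + 1)) k := by
  rw [cyl, cyl, image_image]
  rfl

theorem cyl_succ_subset (w : ℕ → A) (k : ℕ) : G.cyl w (k + 1) ⊆ G.cyl w k := by
  rintro _ ⟨x, hx, rfl⟩
  exact ⟨_, G.map_mem (w k) x hx, (G.comp_succ_last w k x).symm⟩

theorem continuous_comp (w : ℕ → A) (k : ℕ) : Continuous (G.comp w k) := by
  refine (LipschitzWith.of_dist_le_mul (K := 1) fun x y => ?_).continuous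
  rw [Real.dist_eq, Real.dist_eq, G.dist_comp]
  exact mul_le_mul_of_nonneg_right
    (by simpa using pow_le_one₀ G.ratio_pos.le G.ratio_lt.le) (abs_nonneg _)

theorem dist_le_of_mem_cyl {w : ℕ → A} {k : ℕ} {x y : ℝ} (hx : x ∈ G.cyl w k)
    (hy : y ∈ G.cyl w k) : |x - y| ≤ G.ratio ^ k := by
  obtain ⟨x, hx, rfl⟩ := hx
  obtain ⟨y, hy, rfl⟩ := hy
  rw [G.dist_comp]
  refine mul_le_of_le_one_right (pow_nonneg G.ratio_pos.le k) ?_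
  rw [abs_le]
  constructor <;> linarith [hx.1, hx.2, hy.1, hy.2]

theorem exists_mem_cyl (w : ℕ → A) : ∃ x, ∀ k, x ∈ G.cyl w k := by
  have hc : ∀ k, IsCompact (G.cyl w k) := fun k => isCompact_Icc.image (G.continuous_comp w k)
  obtain ⟨x, hx⟩ := IsCompact.nonempty_iInter_of_sequence_nonempty_isCompact_isClosed (G.cyl w)
    (G.cyl_succ_subset w) (fun k => (nonempty_Icc.2 zero_le_one).image _) (hc 0)
    (fun k => (hc k).isClosed)
  exact ⟨x, mem_iInter.1 hx⟩

/-- The point of the attractor with address `w`. -/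
noncomputable def point (w : ℕ → A) : ℝ := (G.exists_mem_cyl w).choose

theorem point_mem_cyl (w : ℕ → A) (k : ℕ) : G.point w ∈ G.cyl w k :=
  (G.exists_mem_cyl w).choose_spec k

theorem point_mem_unit (w : ℕ → A) : G.point w ∈ Icc (0 : ℝ) 1 :=
  G.cyl_subset_unit w 0 (G.point_mem_cyl w 0)

theorem eq_point_of_mem_cyl {w : ℕ → A} {x : ℝ} (hx : ∀ k, x ∈ G.cyl w (k + 1)) :
    x = G.point w := by
  have h : |x - G.point w| ≤ 0 :=
    ge_of_tendsto' (tendsto_pow_atTop_nhds_zero_of_lt_one G.ratio_pos.le G.ratio_lt) fun k =>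
      G.dist_le_of_mem_cyl (G.cyl_succ_subset w k (hx k)) (G.point_mem_cyl w k)
  exact sub_eq_zero.1 (abs_nonpos_iff.1 h)

theorem forall_mem_cyl_iff {w : ℕ → A} {x : ℝ} : (∀ k, x ∈ G.cyl w (k + 1)) ↔ x = G.point w :=
  ⟨G.eq_point_of_mem_cyl, fun h k => h ▸ G.point_mem_cyl w (k + 1)⟩

theorem eq_of_mem_cyl {w w' : ℕ → A} {k : ℕ} {x : ℝ} (h : x ∈ G.cyl w k) (h' : x ∈ G.cyl w' k) :
    ∀ j < k, w j = w' j := by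
  obtain ⟨u, hu, rfl⟩ := h
  obtain ⟨v, hv, huv⟩ := h'
  exact G.eq_of_comp_eq hu hv huv.symm

theorem point_injective : Function.Injective G.point := by
  intro w w' h
  funext j
  exact G.eq_of_mem_cyl (G.point_mem_cyl w (j + 1)) (h ▸ G.point_mem_cyl w' (j + 1)) j
    (Nat.lt_succ_self j)

/-- Words with a common prefix of length `k` have points in one cylinder, of diameter at most `ratio
^ k`. -/
theorem continuous_point [TopologicalSpace A] [DiscreteTopology A] : Continuous G.point := by
  refine continuous_iff_continuousAt.2 fun w => Metric.tendsto_nhds.2 fun ε hε => ?_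
  obtain ⟨k, hk⟩ := exists_pow_lt_of_lt_one hε G.ratio_lt
  have hopen : ∀ᶠ w' in nhds w, ∀ j ∈ Finset.range k, w' j = w j := by
    refine (Filter.eventually_all_finset _).2 fun j _ => ?_
    have hj : ∀ᶠ a in nhds (w j), a = w j := by simp
    exact (continuous_apply j).continuousAt.eventually hj
  filter_upwards [hopen] with w' hw'
  have h := G.point_mem_cyl w' k
  rw [G.cyl_congr fun j hj => hw' j (Finset.mem_range.2 hj)] at h
  exact (G.dist_le_of_mem_cyl h (G.point_mem_cyl w k)).trans_lt hk

/-- A point that lies in cylinders of every depth has an address. -/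
theorem exists_eq_point {x : ℝ} (h : ∀ k, ∃ w, x ∈ G.cyl w k) : ∃ w, x = G.point w := by
  choose W hW using h
  -- Diagonal word: since the cylinders are nested, the words `W k` agree on common prefixes, so
  -- letter `j` may be read from any depth above `j`.
  refine ⟨fun j => W (j + 1) j, G.eq_point_of_mem_cyl fun k => ?_⟩
  have hanti : ∀ w, Antitone (G.cyl w) := fun w => antitone_nat_of_succ_le (G.cyl_succ_subset w)
  rw [G.cyl_congr (w' := W (k + 1)) fun j hj => ?_]
  · exact hW (k + 1)
  · exact G.eq_of_mem_cyl (hW (j + 1)) (hanti _ (by omega) (hW (k + 1))) j (Nat.lt_succ_self j)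

end UnitIFS

/-! ### Affine branches -/

/-- The affine map with slope `±c` of the unit interval onto `[l, l + c]`. -/
def branch (l c : ℝ) (r : Bool) (x : ℝ) : ℝ := l + if r then c * (1 - x) else c * x

theorem branch_mem {l c : ℝ} (hc : 0 ≤ c) (r : Bool) {x : ℝ} (hx : x ∈ Icc (0 : ℝ) 1) :
    branch l c r x ∈ Icc l (l + c) := by
  obtain ⟨h0, h1⟩ := hx
  cases r <;> simp only [branch, if_true, Bool.false_eq_true, if_false] <;>
    constructor <;> nlinarith

theorem exists_branch_eq {l c : ℝ} (hc : 0 < c) (r : Bool) {y : ℝ} (hy : y ∈ Icc l (l + c)) :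
    ∃ x ∈ Icc (0 : ℝ) 1, branch l c r x = y := by
  have h0 : 0 ≤ (y - l) / c := div_nonneg (by linarith [hy.1]) hc.le
  have h1 : (y - l) / c ≤ 1 := (div_le_one hc).2 (by linarith [hy.2])
  have h2 : c * ((y - l) / c) = y - l := by field_simp
  cases r
  · refine ⟨(y - l) / c, ⟨h0, h1⟩, ?_⟩
    simp only [branch, Bool.false_eq_true, if_false]
    linarith
  · refine ⟨1 - (y - l) / c, ⟨by linarith, by linarith⟩, ?_⟩
    simp only [branch, if_true]
    linarith

theorem dist_branch {l c : ℝ} (hc : 0 < c) (r : Bool) (x y : ℝ) :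
    |branch l c r x - branch l c r y| = c * |x - y| := by
  cases r
  · rw [← abs_of_pos hc, ← abs_mul, abs_of_pos hc]
    simp only [branch, Bool.false_eq_true, if_false]
    congr 1
    ring
  · rw [abs_sub_comm x y, ← abs_of_pos hc, ← abs_mul, abs_of_pos hc]
    simp only [branch, if_true]
    congr 1
    ring

/-- The system of affine branches onto pairwise disjoint intervals `[l a, l a + c] ⊆ [0, 1]`. -/
def branchIFS {A : Type*} (l : A → ℝ) (c : ℝ) (r : A → Bool) (hc : 0 < c) (hc1 : c < 1)
    (hl : ∀ a, 0 ≤ l a ∧ l a + c ≤ 1)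
    (hd : Pairwise fun a b => Disjoint (Icc (l a) (l a + c)) (Icc (l b) (l b + c))) :
    UnitIFS A where
  map a := branch (l a) c (r a)
  ratio := c
  ratio_pos := hc
  ratio_lt := hc1
  map_mem a _ hx := Icc_subset_Icc (hl a).1 (hl a).2 (branch_mem hc.le (r a) hx)
  dist_map a := dist_branch hc (r a)
  eq_of_map_eq a b x hx y hy h := by
    by_contra hab
    exact disjoint_left.1 (hd hab) (branch_mem hc.le (r a) hx) (h ▸ branch_mem hc.le (r b) hy)

theorem exists_trans_eq {N : ℕ} (hN : 1 ≤ N) (t : BackLetter) :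
    ∃ s : ForwLetter N, trans s = t := by
  cases t
  · exact ⟨Sum.inl ⟨0, hN⟩, rfl⟩
  · exact ⟨Sum.inr ⟨0, hN⟩, rfl⟩

/-! ### Two-sided sequences and the full zip shift -/

theorem biseq_injective {A A' : Type*} :
    Function.Injective fun q : (ℕ → A) × (ℕ → A') => biseq q.1 q.2 := by
  intro q q' h
  refine Prod.ext (funext fun k => ?_) (funext fun k => ?_)
  · exact Sum.inl_injective (congrFun h (Int.negSucc k))
  · exact Sum.inr_injective (congrFun h (Int.ofNat k))

theorem continuous_biseq {A A' : Type*} [TopologicalSpace A] [TopologicalSpace A'] :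
    Continuous fun q : (ℕ → A) × (ℕ → A') => biseq q.1 q.2 := by
  refine continuous_pi fun i => ?_
  cases i with
  | ofNat k => exact continuous_inr.comp ((continuous_apply k).comp continuous_snd)
  | negSucc k => exact continuous_inl.comp ((continuous_apply k).comp continuous_fst)

/-- If `φ` is onto, the full zip shift space consists of all sequences with letters of `A'` at the
indices `i ≥ 0` and letters of `A` at the indices `i < 0`. -/
theorem zipShiftSpace_univ_eq_range {A A' : Type*} {φ : A' → A} (hφ : Function.Surjective φ) :
    zipShiftSpace univ (fun w : Fin 1 → A' => φ (w 0)) =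
      range fun q : (ℕ → A) × (ℕ → A') => biseq q.1 q.2 := by
  ext x
  constructor
  · rintro ⟨y, -, hy⟩
    refine ⟨(fun k => φ (y (Int.negSucc k)), fun k => y (Int.ofNat k)), funext fun i => ?_⟩
    rw [hy i]
    cases i with
    | ofNat k => rw [if_pos (show (0 : ℤ) ≤ Int.ofNat k from Int.natCast_nonneg k)]; rfl
    | negSucc k => rw [if_neg (not_le.2 (Int.negSucc_lt_zero k))]; simp [biseq]
  · rintro ⟨⟨t, s⟩, rfl⟩
    -- Lifting each backward letter to an arbitrary preimage under `φ` gives the required sequence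
    -- over `A'`.
    choose σ hσ using hφ
    refine ⟨fun i => match i with
      | Int.ofNat k => s k
      | Int.negSucc k => σ (t k), mem_univ _, fun i => ?_⟩
    cases i with
    | ofNat k => rw [if_pos (show (0 : ℤ) ≤ Int.ofNat k from Int.natCast_nonneg k)]; rfl
    | negSucc k => rw [if_neg (not_le.2 (Int.negSucc_lt_zero k))]; simp [biseq, hσ]

/-! ### Horizontal and vertical dynamics of the horseshoe -/

namespace Horseshoe

variable {N : ℕ} (F : Horseshoe N)

theorem two_lt_expansion : 2 < F.δ := by
  have h : (1 : ℝ) ≤ N := by exact_mod_cast F.one_le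
  linarith [F.lt_expansion]

theorem inv_expansion_pos : 0 < 1 / F.δ := one_div_pos.2 (by linarith [F.two_lt_expansion])

theorem inv_expansion_lt : 1 / F.δ < 1 := by
  rw [div_lt_one] <;> linarith [F.two_lt_expansion]

theorem contraction_lt_one : F.δ' < 1 := by
  have h : (1 : ℝ) ≤ N := by exact_mod_cast F.one_le
  exact F.contraction_lt.trans_le ((div_le_one (by linarith)).2 h)

/-- The inverse branches of the horizontal component. -/
noncomputable def horIFS : UnitIFS (ForwLetter N) :=
  branchIFS F.left (1 / F.δ) F.flipX F.inv_expansion_pos F.inv_expansion_lt F.left_mem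
    F.left_disjoint

/-- The branches of the vertical component. -/
noncomputable def verIFS : UnitIFS BackLetter :=
  branchIFS F.base F.δ' F.flipY F.contraction_pos F.contraction_lt_one F.base_mem F.base_disjoint

/-- One step of `f` strips a letter `s` from the horizontal address and prepends `φ₁ s` to the
vertical one. -/
theorem f_horIFS_map (s : ForwLetter N) {x y : ℝ} (hx : x ∈ Icc (0 : ℝ) 1)
    (hy : y ∈ Icc (0 : ℝ) 1) :
    F.f (F.horIFS.map s x, y) = (x, F.verIFS.map (trans s) y) := by
  have h := F.f_branch s _ (branch_mem F.inv_expansion_pos.le (F.flipX s) hx) y hy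
  have hδ : F.δ ≠ 0 := by linarith [F.two_lt_expansion]
  refine h.trans (Prod.ext ?_ rfl)
  cases hs : F.flipX s <;> simp [branch] <;> field_simp
  ring

theorem mem_V_iff {s : ForwLetter N} {p : ℝ × ℝ} :
    p ∈ F.V s ↔ (∃ x ∈ Icc (0 : ℝ) 1, F.horIFS.map s x = p.1) ∧ p.2 ∈ Icc (0 : ℝ) 1 := by
  refine and_congr_left fun _ => ⟨exists_branch_eq F.inv_expansion_pos (F.flipX s), ?_⟩
  rintro ⟨x, hx, h⟩
  exact h ▸ branch_mem F.inv_expansion_pos.le (F.flipX s) hx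

theorem mem_H_iff {t : BackLetter} {p : ℝ × ℝ} :
    p ∈ F.H t ↔ p.1 ∈ Icc (0 : ℝ) 1 ∧ ∃ y ∈ Icc (0 : ℝ) 1, F.verIFS.map t y = p.2 := by
  refine and_congr_right fun _ => ⟨exists_branch_eq F.contraction_pos (F.flipY t), ?_⟩
  rintro ⟨x, hx, h⟩
  exact h ▸ branch_mem F.contraction_pos.le (F.flipY t) hx

theorem V_subset_square (s : ForwLetter N) : F.V s ⊆ square := fun _ hp =>
  ⟨Icc_subset_Icc (F.left_mem s).1 (F.left_mem s).2 hp.1, hp.2⟩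

theorem H_subset_square (t : BackLetter) : F.H t ⊆ square := fun _ hp =>
  ⟨hp.1, Icc_subset_Icc (F.base_mem t).1 (F.base_mem t).2 hp.2⟩

theorem exists_mem_V {p : ℝ × ℝ} (hp : p ∈ square) (hfp : F.f p ∈ square) : ∃ s, p ∈ F.V s := by
  have h : p ∈ square ∩ F.f ⁻¹' square := ⟨hp, hfp⟩
  rw [F.preimage_eq] at h
  exact mem_iUnion.1 h

/-- Vertical words grow at the latest time, cylinders at the outermost branch; splitting off time
`0` reconciles the two. -/
theorem mem_Vword_succ {s : ℕ → ForwLetter N} {k : ℕ} {p : ℝ × ℝ} :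
    p ∈ F.Vword s (k + 1) ↔ p ∈ F.V (s 0) ∧ F.f p ∈ F.Vword (fun i => s (i + 1)) k := by
  induction k with
  | zero => rfl
  | succ k ih =>
    rw [Vword, mem_inter_iff, ih, Vword, mem_inter_iff, and_assoc]
    rfl

theorem Vword_eq (s : ℕ → ForwLetter N) (k : ℕ) :
    F.Vword s k = F.horIFS.cyl s (k + 1) ×ˢ Icc 0 1 := by
  induction k generalizing s with
  | zero =>
    ext p
    exact F.mem_V_iff
  | succ k ih =>
    ext ⟨u, y⟩
    rw [mem_Vword_succ, ih, F.horIFS.cyl_succ s (k + 1), mem_V_iff, mem_prod, mem_prod]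
    constructor
    · rintro ⟨⟨⟨x, hx, rfl⟩, hy⟩, h, -⟩
      rw [F.f_horIFS_map _ hx hy] at h
      exact ⟨⟨x, h, rfl⟩, hy⟩
    · rintro ⟨⟨x, hxc, rfl⟩, hy⟩
      have hx := F.horIFS.cyl_subset_unit _ _ hxc
      rw [F.f_horIFS_map _ hx hy]
      exact ⟨⟨⟨x, hx, rfl⟩, hy⟩, hxc, F.verIFS.map_mem _ _ hy⟩

theorem Vlim_eq (s : ℕ → ForwLetter N) : F.Vlim s = {F.horIFS.point s} ×ˢ Icc 0 1 := by
  ext p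
  simp only [Vlim, Vword_eq, mem_iInter, mem_prod, forall_and, forall_const,
    F.horIFS.forall_mem_cyl_iff, mem_singleton_iff]

theorem mem_Vlim_iff {s : ℕ → ForwLetter N} {p : ℝ × ℝ} :
    p ∈ F.Vlim s ↔ ∀ k, F.f^[k] p ∈ F.V (s k) := by
  rw [Vlim, mem_iInter]
  constructor
  · intro h k
    cases k with
    | zero => exact h 0
    | succ k => exact (h (k + 1)).2
  · intro h k
    induction k with
    | zero => exact h 0
    | succ k ih => exact ⟨ih, h (k + 1)⟩

/-- An orbit segment that starts and ends in the square stays there, and its vertical component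
follows the vertical branches. -/
theorem exists_iterate_snd_eq {k : ℕ} {p : ℝ × ℝ} (hp : p ∈ square) (hk : F.f^[k] p ∈ square) :
    ∃ w, (F.f^[k] p).2 = F.verIFS.comp w k p.2 := by
  induction k with
  | zero => exact ⟨fun _ => false, rfl⟩
  | succ k ih =>
    have hk' : F.f^[k] p ∈ square := (F.nested k ⟨hp, hk⟩).2
    obtain ⟨w, hw⟩ := ih hk'
    rw [Function.iterate_succ_apply'] at hk ⊢
    obtain ⟨s, hs⟩ := F.exists_mem_V hk' hk
    obtain ⟨⟨x, hx, hxp⟩, hy⟩ := F.mem_V_iff.1 hs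
    -- The latest branch is applied outermost, so its letter goes to the front of the word.
    refine ⟨fun i => Nat.casesOn i (trans s) w, ?_⟩
    have h := F.f_horIFS_map s hx hy
    rw [hxp] at h
    rw [show F.f (F.f^[k] p) = _ from h, hw]
    rfl

/-- Every composition of vertical branches is realized by an orbit segment that ends in a given
vertical line. -/
theorem exists_iterate_eq (w : ℕ → BackLetter) (k : ℕ) {x y : ℝ} (hx : x ∈ Icc (0 : ℝ) 1)
    (hy : y ∈ Icc (0 : ℝ) 1) :
    ∃ u ∈ Icc (0 : ℝ) 1, F.f^[k] (u, y) = (x, F.verIFS.comp w k y) := by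
  induction k generalizing w x with
  | zero => exact ⟨x, hx, rfl⟩
  | succ k ih =>
    obtain ⟨s, hs⟩ := exists_trans_eq F.one_le (w 0)
    -- The shorter orbit is aimed at the point of `V_s` over which `f` has horizontal coordinate
    -- `x`.
    obtain ⟨u, hu, h⟩ := ih (fun i => w (i + 1)) (F.horIFS.map_mem s x hx)
    refine ⟨u, hu, ?_⟩
    rw [Function.iterate_succ_apply', h, F.f_horIFS_map s hx (F.verIFS.comp_mem _ k hy), hs]
    rfl

theorem Hword_eq (t : ℕ → BackLetter) (k : ℕ) :
    F.Hword t k = Icc 0 1 ×ˢ F.verIFS.cyl t (k + 1) := by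
  induction k with
  | zero =>
    ext p
    exact F.mem_H_iff
  | succ k ih =>
    rw [Hword, ih]
    ext q
    constructor
    · rintro ⟨⟨hq1, hq2⟩, p, hp, rfl⟩
      refine ⟨hq1, ?_⟩
      obtain ⟨w, hw⟩ := F.exists_iterate_snd_eq (F.H_subset_square _ hp)
        ⟨hq1, F.verIFS.cyl_subset_unit _ _ hq2⟩
      -- The word `w` followed by the orbit is a priori unrelated to `t`; the endpoint lies in
      -- cylinders of both, so their first `k + 1` letters agree.
      have hwt := F.verIFS.eq_of_mem_cyl ⟨_, (F.H_subset_square _ hp).2, hw.symm⟩ hq2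
      obtain ⟨-, y, hy, hyp⟩ := F.mem_H_iff.1 hp
      refine ⟨y, hy, ?_⟩
      rw [hw, F.verIFS.comp_congr hwt, F.verIFS.comp_succ_last t (k + 1), hyp]
    · rintro ⟨hq1, hq2⟩
      refine ⟨⟨hq1, F.verIFS.cyl_succ_subset _ _ hq2⟩, ?_⟩
      obtain ⟨y, hy, hyq⟩ := hq2
      obtain ⟨u, hu, h⟩ := F.exists_iterate_eq t (k + 1) hq1 (F.verIFS.map_mem (t (k + 1)) y hy)
      refine ⟨(u, F.verIFS.map (t (k + 1)) y), F.mem_H_iff.2 ⟨hu, y, hy, rfl⟩, ?_⟩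
      rw [h, ← F.verIFS.comp_succ_last t (k + 1), hyq]

theorem Hlim_eq (t : ℕ → BackLetter) : F.Hlim t = Icc 0 1 ×ˢ {F.verIFS.point t} := by
  ext p
  simp only [Hlim, Hword_eq, mem_iInter, mem_prod, forall_and, forall_const,
    F.verIFS.forall_mem_cyl_iff, mem_singleton_iff]

/-! ### Coding the points of `Λ` -/

/-- The point with the backward letters `q.1` and the forward letters `q.2`. -/
noncomputable def codedPoint (q : (ℕ → BackLetter) × (ℕ → ForwLetter N)) : ℝ × ℝ :=
  (F.horIFS.point q.2, F.verIFS.point q.1)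

theorem Vlim_inter_Hlim (t : ℕ → BackLetter) (s : ℕ → ForwLetter N) :
    F.Vlim s ∩ F.Hlim t = {F.codedPoint (t, s)} := by
  rw [Vlim_eq, Hlim_eq, prod_inter_prod,
    inter_eq_left.2 (singleton_subset_iff.2 (F.horIFS.point_mem_unit s)),
    inter_eq_right.2 (singleton_subset_iff.2 (F.verIFS.point_mem_unit t)), singleton_prod_singleton]
  rfl

theorem codedPoint_injective : Function.Injective F.codedPoint := by
  intro q q' h
  exact Prod.ext (F.verIFS.point_injective (congrArg Prod.snd h))
    (F.horIFS.point_injective (congrArg Prod.fst h))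

theorem continuous_codedPoint : Continuous F.codedPoint :=
  (F.horIFS.continuous_point.comp continuous_snd).prodMk
    (F.verIFS.continuous_point.comp continuous_fst)

theorem codedPoint_mem_lambda (q : (ℕ → BackLetter) × (ℕ → ForwLetter N)) :
    F.codedPoint q ∈ F.lambda := by
  have h : F.codedPoint q ∈ F.Vlim q.2 ∩ F.Hlim q.1 := by
    rw [F.Vlim_inter_Hlim]
    rfl
  obtain ⟨hV, hH⟩ := h
  rw [mem_Vlim_iff] at hV
  rw [Hlim, mem_iInter] at hH
  have hS : F.codedPoint q ∈ square := F.V_subset_square _ (hV 0)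
  refine ⟨mem_iInter.2 fun k => ⟨?_, hS⟩,
    mem_iInter.2 fun k => ⟨F.V_subset_square _ (hV k), hS⟩⟩
  cases k with
  | zero => exact ⟨_, hS, rfl⟩
  -- The last condition defining the horizontal word of index `k + 1` already exhibits a preimage
  -- under `f^[k + 1]` in the square.
  | succ k => exact image_mono (F.H_subset_square _) (hH (k + 1)).2

theorem exists_codedPoint_eq {p : ℝ × ℝ} (hp : p ∈ F.lambda) : ∃ q, F.codedPoint q = p := by
  obtain ⟨hH, hV⟩ := hp
  rw [lambdaH, mem_iInter] at hH
  rw [lambdaV, mem_iInter] at hV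
  have hs : ∀ k, ∃ s, F.f^[k] p ∈ F.V s := fun k => by
    refine F.exists_mem_V (hV k).1 ?_
    rw [← Function.iterate_succ_apply' F.f]
    exact (hV (k + 1)).1
  choose s hs using hs
  have hps := F.mem_Vlim_iff.2 hs
  rw [Vlim_eq] at hps
  -- Preimages of different orders need not lie on one backward orbit; only the vertical cylinders
  -- they yield matter.
  have hcyl : ∀ k, ∃ w, p.2 ∈ F.verIFS.cyl w k := fun k => by
    obtain ⟨⟨p', hp', h⟩, hpS⟩ := hH k
    rw [← h] at hpS ⊢
    obtain ⟨w, hw⟩ := F.exists_iterate_snd_eq hp' hpS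
    exact ⟨w, _, hp'.2, hw.symm⟩
  obtain ⟨t, ht⟩ := F.verIFS.exists_eq_point hcyl
  exact ⟨(t, s), Prod.ext hps.1.symm ht.symm⟩

theorem range_codedPoint : range F.codedPoint = F.lambda :=
  Subset.antisymm (range_subset_iff.2 F.codedPoint_mem_lambda) fun _ => F.exists_codedPoint_eq

theorem isCode_iff {p : ℝ × ℝ} {n : ℤ → BackLetter ⊕ ForwLetter N} :
    F.IsCode p n ↔ ∃ q : (ℕ → BackLetter) × (ℕ → ForwLetter N),
      n = biseq q.1 q.2 ∧ p = F.codedPoint q := by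
  simp only [IsCode, Vlim_inter_Hlim, mem_singleton_iff, Prod.exists]

theorem codeSpace_eq_range :
    F.codeSpace = range fun q : (ℕ → BackLetter) × (ℕ → ForwLetter N) => biseq q.1 q.2 := by
  ext n
  simp only [codeSpace, Vlim_inter_Hlim, singleton_nonempty, and_true, mem_ofPred_eq, mem_range,
    Prod.exists, eq_comm]

/-- The homeomorphism from pairs of one-sided sequences to `Λ`. -/
noncomputable def codedPointHomeomorph : (ℕ → BackLetter) × (ℕ → ForwLetter N) ≃ₜ F.lambda :=
  -- Finite alphabets make the source compact, so a continuous injection into the plane is a closed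
  -- embedding.
  (F.continuous_codedPoint.isClosedEmbedding
    F.codedPoint_injective).isEmbedding.toHomeomorph.trans
      (Homeomorph.setCongr F.range_codedPoint)

/-- The homeomorphism from pairs of one-sided sequences to the code space. -/
noncomputable def biseqHomeomorph : (ℕ → BackLetter) × (ℕ → ForwLetter N) ≃ₜ F.codeSpace :=
  (continuous_biseq.isClosedEmbedding biseq_injective).isEmbedding.toHomeomorph.trans
    (Homeomorph.setCongr F.codeSpace_eq_range.symm)

end Horseshoe

end ZipShift

theorem mainTheorem2 (N : ℕ) (F : ZipShift.Horseshoe N) :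
    -- the code space is the full zip shift space of `φ₁`
    F.codeSpace = ZipShift.zipShiftSpace Set.univ
        (fun w : Fin 1 → ZipShift.ForwLetter N => ZipShift.trans (w 0)) ∧
    -- the nested vertical and horizontal sets shrink to segments that cross the whole square
    (∀ s, ∃ x₀ ∈ Set.Icc (0 : ℝ) 1, F.Vlim s = {x₀} ×ˢ Set.Icc 0 1) ∧
    (∀ t, ∃ y₀ ∈ Set.Icc (0 : ℝ) 1, F.Hlim t = Set.Icc 0 1 ×ˢ {y₀}) ∧
    -- a vertical and a horizontal limit segment meet in one point, which lies in `Λ`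
    (∀ s t, ∃ p ∈ F.lambda, F.Vlim s ∩ F.Hlim t = {p}) ∧
    -- every point of `Λ` arises so, from one pair of segments only
    (∀ p ∈ F.lambda, ∃! ts : (ℕ → ZipShift.BackLetter) × (ℕ → ZipShift.ForwLetter N),
      F.Vlim ts.2 ∩ F.Hlim ts.1 = {p}) ∧
    -- so every point of `Λ` has exactly one code, and the code map is a homeomorphism
    (∀ p ∈ F.lambda, ∃! n, F.IsCode p n) ∧
    ∃ ς : F.lambda ≃ₜ F.codeSpace, ∀ p : F.lambda, F.IsCode p (ς p) := by
  refine ⟨?_, fun s => ⟨_, F.horIFS.point_mem_unit s, F.Vlim_eq s⟩,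
    fun t => ⟨_, F.verIFS.point_mem_unit t, F.Hlim_eq t⟩,
    fun s t => ⟨_, F.codedPoint_mem_lambda (t, s), F.Vlim_inter_Hlim t s⟩, fun p hp => ?_,
    fun p hp => ?_, F.codedPointHomeomorph.symm.trans F.biseqHomeomorph, fun p => ?_⟩
  · rw [F.codeSpace_eq_range,
      ZipShift.zipShiftSpace_univ_eq_range (ZipShift.exists_trans_eq F.one_le)]
  · obtain ⟨q, rfl⟩ := F.exists_codedPoint_eq hp
    refine ⟨q, F.Vlim_inter_Hlim q.1 q.2, fun q' hq' => F.codedPoint_injective ?_⟩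
    exact Set.singleton_injective ((F.Vlim_inter_Hlim q'.1 q'.2).symm.trans hq')
  · obtain ⟨q, rfl⟩ := F.exists_codedPoint_eq hp
    refine ⟨_, F.isCode_iff.2 ⟨q, rfl, rfl⟩, fun n hn => ?_⟩
    obtain ⟨q', rfl, hq'⟩ := F.isCode_iff.1 hn
    rw [F.codedPoint_injective hq']
  · obtain ⟨q, rfl⟩ := F.codedPointHomeomorph.surjective p
    refine F.isCode_iff.2 ⟨q, ?_, rfl⟩
    rw [Homeomorph.trans_apply, Homeomorph.symm_apply_apply]
    rfl
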